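/- Let $M$ be a smooth manifold and let $(E,\rho_E,[\cdot,\cdot]_E)$ be a Lie algebroid over $M$ of rank $2m+1$: $E\to M$ is a smooth real vector bundle of rank $2m+1$, $\rho_E:E\to TM$ is a smooth bundle map (the anchor), and $[\cdot,\cdot]_E$ is a real Lie bracket on $\Gamma(E)$ with $[s_1,fs_2]_E=f[s_1,s_2]_E+\rho_E(s_1)(f)\,s_2$ for $f\in C^\infty(M)$. Let $(F_E,\xi,\eta,g_E)$ be an almost contact Riemannian structure on $E$, that is, $F_E\in\Gamma(E\otimes E^*)$, $\xi\in\Gamma(E)$, $\eta\in\Gamma(E^*)$ and a Riemannian metric $g_E$ on $E$ such that $$F_E^2=-I_E+\eta\otimes\xi,\qquad \eta(\xi)=1,\qquad g_E(F_E(s_1),F_E(s_2))=g_E(s_1,s_2)-\eta(s_1)\eta(s_2).$$ Let $\Omega_E(s_1,s_2)=g_E(s_1,F_E(s_2))$ be its fundamental $2$-form, and let $\nabla$ be the Levi-Civita connection of $g_E$, i.e. the linear connection $\nabla:\Gamma(E)\times\Gamma(E)\to\Gamma(E)$ of the Lie algebroid with $\nabla g_E=0$ and $\nabla_{s_1}s_2-\nabla_{s_2}s_1=[s_1,s_2]_E$.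 Put $(\nabla_{s_1}F_E)s_2=\nabla_{s_1}(F_E(s_2))-F_E(\nabla_{s_1}s_2)$. The exterior derivative and the wedge product are normalized by $$2\,d_E\eta(s_0,s_1)=\rho_E(s_0)(\eta(s_1))-\rho_E(s_1)(\eta(s_0))-\eta([s_0,s_1]_E),$$ $$\begin{aligned}3\,d_E\Omega_E(s_0,s_1,s_2)={}&\rho_E(s_0)(\Omega_E(s_1,s_2))-\rho_E(s_1)(\Omega_E(s_0,s_2))+\rho_E(s_2)(\Omega_E(s_0,s_1))\\&-\Omega_E([s_0,s_1]_E,s_2)+\Omega_E([s_0,s_2]_E,s_1)-\Omega_E([s_1,s_2]_E,s_0),\end{aligned}$$ $$3\,(\eta\wedge\Omega_E)(s_0,s_1,s_2)=\eta(s_0)\Omega_E(s_1,s_2)-\eta(s_1)\Omega_E(s_0,s_2)+\eta(s_2)\Omega_E(s_0,s_1).$$ The structure is called normal if $N_{F_E}+2\,d_E\eta\otimes\xi=0$, where $$N_{F_E}(s_1,s_2)=[F_E(s_1),F_E(s_2)]_E-F_E([F_E(s_1),s_2]_E)-F_E([s_1,F_E(s_2)]_E)+F_E^2([s_1,s_2]_E),$$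 and $E$, with this structure, is called a Kenmotsu Lie algebroid if the structure is normal, $d_E\eta=0$ and $d_E\Omega_E=2\,\eta\wedge\Omega_E$. **Theorem.** $E$ with $(F_E,\xi,\eta,g_E)$ is a Kenmotsu Lie algebroid if and only if $$(\nabla_{s_1}F_E)s_2=-\eta(s_2)F_E(s_1)-g_E(s_1,F_E(s_2))\,\xi\qquad\text{for all } s_1,s_2\in\Gamma(E).$$ -/

import Mathlib

open scoped Manifold ContDiff Bundle

noncomputable section

section AlgebroidGeometry

variable {n : ℕ} {M : Type*} [TopologicalSpace M] [ChartedSpace (EuclideanSpace ℝ (Fin n)) M]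
  [IsManifold (𝓡 n) ∞ M]
  {F : Type*} [NormedAddCommGroup F] [NormedSpace ℝ F]
  {E : M → Type*} [TopologicalSpace (Bundle.TotalSpace F E)]
  [∀ x, TopologicalSpace (E x)] [∀ x, AddCommGroup (E x)] [∀ x, Module ℝ (E x)]
  [∀ x, IsTopologicalAddGroup (E x)] [∀ x, ContinuousSMul ℝ (E x)]
  [FiberBundle F E] [VectorBundle ℝ F E] [ContMDiffVectorBundle ∞ F E (𝓡 n)]

variable (n F E) in
/-- `Γ(E)`: the smooth global sections of the vector bundle `E → M` with typical fibre `F`. -/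
abbrev SmoothSec : Type _ := Cₛ^∞⟮𝓡 n; F, E⟯

variable (n F E) in
/-- `Γ(E ⊗ E*)`: the smooth fields of endomorphisms of `E`. -/
abbrev EndSec : Type _ := Cₛ^∞⟮𝓡 n; F →L[ℝ] F, fun x => E x →L[ℝ] E x⟯

variable (n F E) in
/-- `Γ(E*)`: the smooth 1-forms on `E`. -/
abbrev OneFormSec : Type _ := Cₛ^∞⟮𝓡 n; F →L[ℝ] ℝ, fun x => E x →L[ℝ] Bundle.Trivial M ℝ x⟯

variable (n F E) in
/-- The smooth vector bundle morphisms `E → TM` over the identity of `M`. -/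
abbrev AnchorMap : Type _ :=
  Cₛ^∞⟮𝓡 n; F →L[ℝ] EuclideanSpace ℝ (Fin n), fun x => E x →L[ℝ] TangentSpace (𝓡 n) x⟯

/-- The product `f s` of a smooth function and a smooth section. -/
def SmoothSec.fsmul (f : C^∞⟮𝓡 n, M; ℝ⟯) (s : SmoothSec n F E) : SmoothSec n F E :=
  ⟨fun x => f x • s x, f.contMDiff.smul_section s.contMDiff⟩

/-- The section `A(s)` obtained by applying a field of endomorphisms to a section. -/
def EndSec.app (A : EndSec n F E) (s : SmoothSec n F E) : SmoothSec n F E :=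
  ⟨fun x => A x (s x), A.contMDiff.clm_bundle_apply s.contMDiff⟩

/-- The function `η(s)`. -/
def OneFormSec.app (η : OneFormSec n F E) (s : SmoothSec n F E) : M → ℝ :=
  fun x => η x (s x)

/-- For a bundle map `ρ : E → TM`, the derivative `ρ(s)(f)` of the function `f` along the vector
field `ρ(s)`. -/
def AnchorMap.deriv (ρ : AnchorMap n F E) (s : SmoothSec n F E) (f : M → ℝ) : M → ℝ :=
  fun x => mfderiv (𝓡 n) 𝓘(ℝ, ℝ) f x (ρ x (s x))

variable (n F E) in
/-- A Lie algebroid structure on the smooth vector bundle `E → M`: an anchor `ρ : E → TM` and a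
real Lie bracket on `Γ(E)` with `[s₁, f s₂] = f [s₁, s₂] + ρ(s₁)(f) s₂`. -/
structure LieAlgebroid where
  anchor : AnchorMap n F E
  bracket : SmoothSec n F E → SmoothSec n F E → SmoothSec n F E
  bracket_add_left : ∀ s₁ s₂ s₃, bracket (s₁ + s₂) s₃ = bracket s₁ s₃ + bracket s₂ s₃
  bracket_add_right : ∀ s₁ s₂ s₃, bracket s₁ (s₂ + s₃) = bracket s₁ s₂ + bracket s₁ s₃
  bracket_smul_left : ∀ (c : ℝ) (s₁ s₂), bracket (c • s₁) s₂ = c • bracket s₁ s₂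
  bracket_smul_right : ∀ (c : ℝ) (s₁ s₂), bracket s₁ (c • s₂) = c • bracket s₁ s₂
  bracket_self : ∀ s, bracket s s = 0
  jacobi : ∀ s₁ s₂ s₃,
    bracket s₁ (bracket s₂ s₃) + bracket s₂ (bracket s₃ s₁) + bracket s₃ (bracket s₁ s₂) = 0
  leibniz : ∀ (s₁ : SmoothSec n F E) (f : C^∞⟮𝓡 n, M; ℝ⟯) (s₂ : SmoothSec n F E) (x : M),
    bracket s₁ (s₂.fsmul f) x = f x • bracket s₁ s₂ x + anchor.deriv s₁ f x • s₂ x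

variable (n F E) in
/-- An almost contact structure `(φ, ξ, η)` on the vector bundle `E`:
`φ² = -I + η ⊗ ξ` and `η(ξ) = 1`. -/
structure AlmostContactStr where
  φ : EndSec n F E
  ξ : SmoothSec n F E
  η : OneFormSec n F E
  φ_sq : ∀ (x : M) (v : E x), φ x (φ x v) = -v + (η x v : ℝ) • ξ x
  η_ξ : ∀ x : M, (η x (ξ x) : ℝ) = 1

variable (n F E) in
/-- An almost contact Riemannian structure `(φ, ξ, η, g)` on `E`: an almost contact structure and a
smooth Riemannian metric on `E` with `g(φ v, φ w) = g(v, w) - η(v) η(w)`. -/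
structure AlmostContactRiemannianStr extends AlmostContactStr n F E where
  g : Bundle.ContMDiffRiemannianMetric (𝓡 n) ∞ F E
  compat : ∀ (x : M) (v w : E x),
    g.inner x (φ x v) (φ x w) = g.inner x v w - (η x v : ℝ) * (η x w : ℝ)

/-- The function `g(s₁, s₂)`. -/
def metricApp (g : Bundle.ContMDiffRiemannianMetric (𝓡 n) ∞ F E) (s₁ s₂ : SmoothSec n F E) :
    M → ℝ :=
  fun x => g.inner x (s₁ x) (s₂ x)

/-- The fundamental 2-form `Ω(s₁, s₂) = g(s₁, φ(s₂))`. -/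
def AlmostContactRiemannianStr.Ω (S : AlmostContactRiemannianStr n F E)
    (s₁ s₂ : SmoothSec n F E) : M → ℝ :=
  metricApp S.g s₁ (S.φ.app s₂)

/-- The wedge product of a 1-form and a 2-form, evaluated on three sections, normalized as the
alternation of the tensor product:
`(α ∧ β)(s₀, s₁, s₂) = ⅓ (α(s₀) β(s₁, s₂) - α(s₁) β(s₀, s₂) + α(s₂) β(s₀, s₁))`. -/
def wedgeOneTwo (α : OneFormSec n F E) (β : SmoothSec n F E → SmoothSec n F E → M → ℝ)
    (s₀ s₁ s₂ : SmoothSec n F E) : M → ℝ :=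
  fun x => (1 / 3 : ℝ) *
    (α.app s₀ x * β s₁ s₂ x - α.app s₁ x * β s₀ s₂ x + α.app s₂ x * β s₀ s₁ x)

namespace LieAlgebroid

variable (L : LieAlgebroid n F E)

/-- The exterior derivative `d_E α` of a 1-form, evaluated on two sections. It carries the factor
`1 / (p + 1)` for a `p`-form, in accordance with the normalization of the wedge product. -/
def dOne (α : OneFormSec n F E) (s₀ s₁ : SmoothSec n F E) : M → ℝ :=
  fun x => (1 / 2 : ℝ) *
    (L.anchor.deriv s₀ (α.app s₁) x - L.anchor.deriv s₁ (α.app s₀) x - α.app (L.bracket s₀ s₁) x)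

/-- The exterior derivative `d_E β` of a 2-form, given by its values on pairs of sections,
evaluated on three sections. It carries the factor `1 / (p + 1)` for a `p`-form. -/
def dTwo (β : SmoothSec n F E → SmoothSec n F E → M → ℝ) (s₀ s₁ s₂ : SmoothSec n F E) : M → ℝ :=
  fun x => (1 / 3 : ℝ) *
    (L.anchor.deriv s₀ (β s₁ s₂) x - L.anchor.deriv s₁ (β s₀ s₂) x
      + L.anchor.deriv s₂ (β s₀ s₁) x
      - β (L.bracket s₀ s₁) s₂ x + β (L.bracket s₀ s₂) s₁ x - β (L.bracket s₁ s₂) s₀ x)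

/-- The Nijenhuis tensor `N_A(s₁, s₂) = [A s₁, A s₂] - A[A s₁, s₂] - A[s₁, A s₂] + A²[s₁, s₂]`. -/
def nijenhuis (A : EndSec n F E) (s₁ s₂ : SmoothSec n F E) : SmoothSec n F E :=
  L.bracket (A.app s₁) (A.app s₂) - A.app (L.bracket (A.app s₁) s₂)
    - A.app (L.bracket s₁ (A.app s₂)) + A.app (A.app (L.bracket s₁ s₂))

/-- The almost contact structure `(φ, ξ, η)` is normal: `N_φ + 2 d_E η ⊗ ξ = 0`. -/
def IsNormal (S : AlmostContactStr n F E) : Prop :=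
  ∀ (s₁ s₂ : SmoothSec n F E) (x : M),
    L.nijenhuis S.φ s₁ s₂ x + (2 * L.dOne S.η s₁ s₂ x) • S.ξ x = 0

/-- Almost Kenmotsu: `d_E η = 0` and `d_E Ω = 2 η ∧ Ω`. -/
def IsAlmostKenmotsu (S : AlmostContactRiemannianStr n F E) : Prop :=
  (∀ (s₁ s₂ : SmoothSec n F E) (x : M), L.dOne S.η s₁ s₂ x = 0) ∧
  ∀ (s₁ s₂ s₃ : SmoothSec n F E) (x : M),
    L.dTwo S.Ω s₁ s₂ s₃ x = 2 * wedgeOneTwo S.η S.Ω s₁ s₂ s₃ x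

/-- Kenmotsu: normal and almost Kenmotsu. -/
def IsKenmotsu (S : AlmostContactRiemannianStr n F E) : Prop :=
  L.IsNormal S.toAlmostContactStr ∧ L.IsAlmostKenmotsu S

/-- A linear connection of the Lie algebroid on `E` itself: `∇ s₁ s₂` is `∇_{s₁} s₂`. -/
structure Connection where
  nabla : SmoothSec n F E → SmoothSec n F E → SmoothSec n F E
  add_left : ∀ s₁ s₂ s₃, nabla (s₁ + s₂) s₃ = nabla s₁ s₃ + nabla s₂ s₃
  fsmul_left : ∀ (f : C^∞⟮𝓡 n, M; ℝ⟯) (s₁ s₂ : SmoothSec n F E),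
    nabla (s₁.fsmul f) s₂ = (nabla s₁ s₂).fsmul f
  add_right : ∀ s₁ s₂ s₃, nabla s₁ (s₂ + s₃) = nabla s₁ s₂ + nabla s₁ s₃
  leibniz : ∀ (s₁ : SmoothSec n F E) (f : C^∞⟮𝓡 n, M; ℝ⟯) (s₂ : SmoothSec n F E) (x : M),
    nabla s₁ (s₂.fsmul f) x = f x • nabla s₁ s₂ x + L.anchor.deriv s₁ f x • s₂ x

variable {L}

/-- `∇` is the Levi-Civita connection of `g`: it is metric and torsion-free. -/
structure Connection.IsLeviCivita (D : L.Connection)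
    (g : Bundle.ContMDiffRiemannianMetric (𝓡 n) ∞ F E) : Prop where
  metric : ∀ (s₁ s₂ s₃ : SmoothSec n F E) (x : M),
    L.anchor.deriv s₁ (metricApp g s₂ s₃) x
      = metricApp g (D.nabla s₁ s₂) s₃ x + metricApp g s₂ (D.nabla s₁ s₃) x
  torsion_free : ∀ s₁ s₂ : SmoothSec n F E, D.nabla s₁ s₂ - D.nabla s₂ s₁ = L.bracket s₁ s₂

/-- The covariant derivative of a field of endomorphisms:
`(∇_{s₁} A) s₂ = ∇_{s₁} (A s₂) - A (∇_{s₁} s₂)`. -/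
def Connection.nablaEnd (D : L.Connection) (s₁ : SmoothSec n F E) (A : EndSec n F E)
    (s₂ : SmoothSec n F E) : SmoothSec n F E :=
  D.nabla s₁ (A.app s₂) - A.app (D.nabla s₁ s₂)

end LieAlgebroid

end AlgebroidGeometry

end

set_option linter.unusedSectionVars false

/-! Metricity and vanishing torsion express all the data through `∇φ` and `∇ξ`: `dη` is the skew
part of `∇ξ`, `3 dΩ` is a cyclic sum of `∇φ` (`dTwo_fundamental`), and `N` is a combination of
values of `∇φ` and `φ ∘ ∇φ` (`nijenhuis_apply`).

Forward, as in Koszul's formula, `3 dΩ(s, φt, φu) - 3 dΩ(s, t, u) + g(N(t, u), φs)` equals `2 g((∇_s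
φ)t, u)` up to terms in `η` and `∇ξ`, because `∇_s φ` is skew and anticommutes with `φ` up to such
terms. Since `dη = 0`, `∇ξ` is symmetric and its terms cancel; nondegeneracy of `g` then gives the
formula.

Conversely, the formula at `s₂ = ξ` gives `∇_s ξ = s - η(s)ξ`, which is symmetric, so `dη = 0`;
substitution into the expressions for `N` and `dΩ` gives the rest. -/

section KenmotsuAlgebroid

variable {n : ℕ} {M : Type*} [TopologicalSpace M] [ChartedSpace (EuclideanSpace ℝ (Fin n)) M]
  [IsManifold (𝓡 n) ∞ M]
  {F : Type*} [NormedAddCommGroup F] [NormedSpace ℝ F]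
  {E : M → Type*} [TopologicalSpace (Bundle.TotalSpace F E)]
  [∀ x, TopologicalSpace (E x)] [∀ x, AddCommGroup (E x)] [∀ x, Module ℝ (E x)]
  [∀ x, IsTopologicalAddGroup (E x)] [∀ x, ContinuousSMul ℝ (E x)]
  [FiberBundle F E] [VectorBundle ℝ F E] [ContMDiffVectorBundle ∞ F E (𝓡 n)]

/-- The function `η(s)` as a smooth function. -/
noncomputable def OneFormSec.appSmooth (η : OneFormSec n F E) (s : SmoothSec n F E) :
    C^∞⟮𝓡 n, M; ℝ⟯ :=
  ⟨η.app s, fun x =>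
    (Bundle.contMDiffAt_section (E := Bundle.Trivial M ℝ) x).1
      ((η.contMDiff.clm_bundle_apply s.contMDiff) x)⟩

@[simp] lemma EndSec.app_apply (A : EndSec n F E) (s : SmoothSec n F E) (x : M) :
    A.app s x = A x (s x) := rfl

lemma metricApp_apply (g : Bundle.ContMDiffRiemannianMetric (𝓡 n) ∞ F E) (s t : SmoothSec n F E)
    (x : M) : metricApp g s t x = g.inner x (s x) (t x) := rfl

lemma AnchorMap.deriv_const (ρ : AnchorMap n F E) (s : SmoothSec n F E) (c : ℝ) (x : M) :
    ρ.deriv s (fun _ => c) x = 0 := by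
  rw [AnchorMap.deriv, mfderiv_const]
  rfl

/-! ### Pointwise algebra of almost contact structures. -/

namespace AlmostContactStr

variable (S : AlmostContactStr n F E)

/-- Computing `φ³v` in two ways gives `η(v) φξ = η(φv) ξ`, so it suffices that `φξ = 0`. As `φ²ξ =
0`, the axiom at `φξ` gives `φξ = cξ`; applying `φ` gives `c φξ = 0`. -/
lemma eta_phi (x : M) (v : E x) : (S.η x (S.φ x v) : ℝ) = 0 := by
  have h1 := S.φ_sq x (S.φ x v)
  rw [S.φ_sq x v, map_add, map_neg, map_smul] at h1
  have h2 : (S.η x v : ℝ) • S.φ x (S.ξ x) = (S.η x (S.φ x v) : ℝ) • S.ξ x := by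
    simpa using h1
  have h3 : S.φ x (S.φ x (S.ξ x)) = 0 := by simp [S.φ_sq, S.η_ξ]
  have h4 : S.φ x (S.ξ x) = (S.η x (S.φ x (S.ξ x)) : ℝ) • S.ξ x := by
    have := S.φ_sq x (S.φ x (S.ξ x))
    rw [h3, map_zero] at this
    exact (neg_add_eq_zero.1 this.symm)
  have h5 : S.φ x (S.ξ x) = 0 := by
    have h6 := congrArg (S.φ x) h4
    rw [h3, map_smul] at h6
    rcases smul_eq_zero.1 h6.symm with h | h
    · rw [h4, h, zero_smul]
    · exact h
  rw [h5, smul_zero] at h2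
  have h7 := congrArg (fun w => (S.η x w : ℝ)) h2
  simpa [S.η_ξ] using h7.symm

lemma phi_xi (x : M) : S.φ x (S.ξ x) = 0 := by
  have h3 : S.φ x (S.φ x (S.ξ x)) = 0 := by simp [S.φ_sq, S.η_ξ]
  have h := S.φ_sq x (S.φ x (S.ξ x))
  rw [h3, map_zero, S.eta_phi, zero_smul, add_zero] at h
  exact neg_eq_zero.1 h.symm

lemma phi_app_xi : S.φ.app S.ξ = 0 := by
  ext x
  exact S.phi_xi x

lemma phi_app_phi_app (s : SmoothSec n F E) :
    S.φ.app (S.φ.app s) = -s + S.ξ.fsmul (S.η.appSmooth s) := by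
  ext x
  exact S.φ_sq x (s x)

end AlmostContactStr

namespace AlmostContactRiemannianStr

variable (S : AlmostContactRiemannianStr n F E)

lemma inner_xi (x : M) (v : E x) : S.g.inner x v (S.ξ x) = (S.η x v : ℝ) := by
  have h := S.compat x v (S.ξ x)
  rw [S.phi_xi, map_zero, S.η_ξ] at h
  linarith

lemma inner_phi (x : M) (v w : E x) :
    S.g.inner x (S.φ x v) w = -S.g.inner x v (S.φ x w) := by
  have h := S.compat x (S.φ x v) w
  rw [S.φ_sq, S.eta_phi, map_add, map_neg, map_smul, _root_.add_apply,
    _root_.neg_apply, _root_.smul_apply, S.g.symm x (S.ξ x),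
    S.inner_xi, S.eta_phi] at h
  simp only [smul_zero, add_zero, zero_mul, sub_zero] at h
  exact h.symm

lemma eta_app_eq (s : SmoothSec n F E) : S.η.app s = metricApp S.g s S.ξ :=
  funext fun x => (S.inner_xi x (s x)).symm

/-- The sign sits on the section, so that both sides are metric pairings of sections and metricity
of `∇` differentiates either one. -/
lemma metricApp_phi_left (s t : SmoothSec n F E) :
    metricApp S.g (S.φ.app s) t = metricApp S.g (-s) (S.φ.app t) := by
  funext x
  simpa [metricApp_apply] using S.inner_phi x (s x) (t x)

lemma metricApp_xi_xi : metricApp S.g S.ξ S.ξ = fun _ => 1 := by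
  funext x
  exact (S.inner_xi x (S.ξ x)).trans (S.η_ξ x)

end AlmostContactRiemannianStr

/-! ### `dη`, `dΩ` and `N` in terms of `∇φ` and `∇ξ`. -/

namespace LieAlgebroid.Connection

variable {L : LieAlgebroid n F E} (D : L.Connection)

@[simp] lemma nabla_zero (s : SmoothSec n F E) : D.nabla s 0 = 0 := by
  have h := D.add_right s 0 0
  rwa [add_zero, left_eq_add] at h

@[simp] lemma nabla_neg (s t : SmoothSec n F E) : D.nabla s (-t) = -D.nabla s t := by
  have h := D.add_right s t (-t)
  rw [add_neg_cancel, nabla_zero] at h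
  exact (neg_eq_of_add_eq_zero_right h.symm).symm

lemma nabla_phi (A : EndSec n F E) (s t : SmoothSec n F E) (x : M) :
    D.nabla s (A.app t) x = D.nablaEnd s A t x + A x (D.nabla s t x) := by
  simp [nablaEnd]

lemma nablaEnd_xi (S : AlmostContactStr n F E) (s : SmoothSec n F E) (x : M) :
    D.nablaEnd s S.φ S.ξ x = -S.φ x (D.nabla s S.ξ x) := by
  simp [nablaEnd, S.phi_app_xi]

variable {D} {S : AlmostContactRiemannianStr n F E}

namespace IsLeviCivita

/-- `g((∇_s φ) t, u) = -g(t, (∇_s φ) u)`. -/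
lemma inner_nablaEnd_skew (hD : D.IsLeviCivita S.g) (s t u : SmoothSec n F E) (x : M) :
    S.g.inner x (D.nablaEnd s S.φ t x) (u x) = -S.g.inner x (D.nablaEnd s S.φ u x) (t x) := by
  have h1 := hD.metric s (S.φ.app t) u x
  have h2 := hD.metric s (-t) (S.φ.app u) x
  rw [S.metricApp_phi_left, h2] at h1
  simp only [metricApp_apply, D.nabla_neg, D.nabla_phi, ContMDiffSection.coe_neg, Pi.neg_apply,
    EndSec.app_apply, map_add, map_neg, _root_.add_apply,
    _root_.neg_apply, S.inner_phi] at h1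
  rw [S.g.symm x (D.nablaEnd s S.φ u x)]
  linarith

lemma eta_nabla_xi (hD : D.IsLeviCivita S.g) (s : SmoothSec n F E) (x : M) :
    (S.η x (D.nabla s S.ξ x) : ℝ) = 0 := by
  have h := hD.metric s S.ξ S.ξ x
  rw [S.metricApp_xi_xi, AnchorMap.deriv_const, metricApp_apply, metricApp_apply,
    S.g.symm x (S.ξ x), S.inner_xi] at h
  linarith

lemma deriv_eta (hD : D.IsLeviCivita S.g) (s t : SmoothSec n F E) (x : M) :
    L.anchor.deriv s (S.η.app t) x
      = (S.η x (D.nabla s t x) : ℝ) + S.g.inner x (D.nabla s S.ξ x) (t x) := by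
  rw [S.eta_app_eq, hD.metric, metricApp_apply, metricApp_apply, S.inner_xi, S.g.symm x (t x)]

/-- The covariant derivative of `φ² = -I + η ⊗ ξ`; the last two terms come from `η ⊗ ξ`. -/
lemma nablaEnd_phi_app (hD : D.IsLeviCivita S.g) (s t : SmoothSec n F E) (x : M) :
    D.nablaEnd s S.φ (S.φ.app t) x = -S.φ x (D.nablaEnd s S.φ t x)
      + S.g.inner x (D.nabla s S.ξ x) (t x) • S.ξ x + (S.η x (t x) : ℝ) • D.nabla s S.ξ x := by
  have h1 := D.nabla_phi S.φ s (S.φ.app t) x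
  rw [D.nabla_phi S.φ s t, map_add, S.phi_app_phi_app, D.add_right, D.nabla_neg,
    ContMDiffSection.coe_add, Pi.add_apply, D.leibniz, S.φ_sq] at h1
  have h2 : L.anchor.deriv s (S.η.appSmooth t) x = _ := hD.deriv_eta s t x
  rw [h2] at h1
  have h3 : S.η.appSmooth t x = (S.η x (t x) : ℝ) := rfl
  rw [h3] at h1
  simp only [ContMDiffSection.coe_neg, Pi.neg_apply] at h1
  rw [← sub_eq_iff_eq_add] at h1
  rw [← h1]
  module

/-- `g((∇_s φ)(φ t), u) = g((∇_s φ) t, φ u) + g(∇_s ξ, t) η(u) + η(t) g(∇_s ξ, u)`. -/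
lemma inner_nablaEnd_phi_app (hD : D.IsLeviCivita S.g) (s t u : SmoothSec n F E) (x : M) :
    S.g.inner x (D.nablaEnd s S.φ (S.φ.app t) x) (u x)
      = S.g.inner x (D.nablaEnd s S.φ t x) (S.φ x (u x))
        + S.g.inner x (D.nabla s S.ξ x) (t x) * (S.η x (u x) : ℝ)
        + (S.η x (t x) : ℝ) * S.g.inner x (D.nabla s S.ξ x) (u x) := by
  rw [hD.nablaEnd_phi_app]
  simp only [map_add, map_neg, map_smul, _root_.add_apply,
    _root_.neg_apply, _root_.smul_apply, S.inner_phi, smul_eq_mul,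
    S.g.symm x (S.ξ x), S.inner_xi, neg_neg]

lemma bracket_apply (hD : D.IsLeviCivita S.g) (s t : SmoothSec n F E) (x : M) :
    L.bracket s t x = D.nabla s t x - D.nabla t s x := by
  rw [← hD.torsion_free]
  rfl

lemma dOne_eta (hD : D.IsLeviCivita S.g) (s t : SmoothSec n F E) (x : M) :
    2 * L.dOne S.η s t x
      = S.g.inner x (D.nabla s S.ξ x) (t x) - S.g.inner x (D.nabla t S.ξ x) (s x) := by
  have h : S.η.app (L.bracket s t) x = (S.η x (D.nabla s t x) : ℝ) - S.η x (D.nabla t s x) := by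
    rw [OneFormSec.app, hD.bracket_apply, map_sub]
  rw [LieAlgebroid.dOne, hD.deriv_eta, hD.deriv_eta, h]
  ring

lemma deriv_fundamental (hD : D.IsLeviCivita S.g) (s t u : SmoothSec n F E) (x : M) :
    L.anchor.deriv s (S.Ω t u) x
      = S.g.inner x (D.nabla s t x) (S.φ x (u x)) + S.g.inner x (D.nablaEnd s S.φ u x) (t x)
        - S.g.inner x (D.nabla s u x) (S.φ x (t x)) := by
  rw [AlmostContactRiemannianStr.Ω, hD.metric, metricApp_apply, metricApp_apply, D.nabla_phi,
    S.g.symm x (t x), map_add, _root_.add_apply, S.inner_phi, EndSec.app_apply]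
  ring

/-- With zero torsion the bracket terms cancel every derivative of a section, leaving only `∇φ`. -/
lemma dTwo_fundamental (hD : D.IsLeviCivita S.g) (s t u : SmoothSec n F E) (x : M) :
    3 * L.dTwo S.Ω s t u x
      = S.g.inner x (D.nablaEnd s S.φ u x) (t x) + S.g.inner x (D.nablaEnd t S.φ s x) (u x)
        + S.g.inner x (D.nablaEnd u S.φ t x) (s x) := by
  have hskew := hD.inner_nablaEnd_skew t s u x
  simp only [LieAlgebroid.dTwo, hD.deriv_fundamental]
  simp only [AlmostContactRiemannianStr.Ω, metricApp_apply, hD.bracket_apply, map_sub,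
    _root_.sub_apply, EndSec.app_apply]
  linarith

lemma nijenhuis_apply (hD : D.IsLeviCivita S.g) (s t : SmoothSec n F E) (x : M) :
    L.nijenhuis S.φ s t x
      = D.nablaEnd (S.φ.app s) S.φ t x - D.nablaEnd (S.φ.app t) S.φ s x
        + S.φ x (D.nablaEnd t S.φ s x) - S.φ x (D.nablaEnd s S.φ t x) := by
  simp only [LieAlgebroid.nijenhuis, ContMDiffSection.coe_add, ContMDiffSection.coe_sub,
    Pi.add_apply, Pi.sub_apply, EndSec.app_apply, hD.bracket_apply, D.nabla_phi, map_sub, map_add]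
  abel

end IsLeviCivita

end LieAlgebroid.Connection

/-! ### The two implications. -/

namespace LieAlgebroid

variable {L : LieAlgebroid n F E} {S : AlmostContactRiemannianStr n F E} {D : L.Connection}

lemma three_mul_wedge (s t u : SmoothSec n F E) (x : M) :
    3 * wedgeOneTwo S.η S.Ω s t u x
      = (S.η x (s x) : ℝ) * S.g.inner x (t x) (S.φ x (u x))
        - (S.η x (t x) : ℝ) * S.g.inner x (s x) (S.φ x (u x))
        + (S.η x (u x) : ℝ) * S.g.inner x (s x) (S.φ x (t x)) := by
  simp only [wedgeOneTwo, AlmostContactRiemannianStr.Ω, metricApp_apply, OneFormSec.app,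
    EndSec.app_apply]
  ring

/-- On a Kenmotsu Lie algebroid `g((∇_s φ) t, u) = -η(t) g(φ s, u) - g(s, φ t) η(u)`. -/
lemma IsKenmotsu.inner_nablaEnd (hK : L.IsKenmotsu S) (hD : D.IsLeviCivita S.g)
    (s t u : SmoothSec n F E) (x : M) :
    S.g.inner x (D.nablaEnd s S.φ t x) (u x)
      = -((S.η x (t x) : ℝ) * S.g.inner x (S.φ x (s x)) (u x))
        - S.g.inner x (s x) (S.φ x (t x)) * (S.η x (u x) : ℝ) := by
  obtain ⟨hN, hη, hΩ⟩ := hK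
  have hsymm (p q : SmoothSec n F E) :
      S.g.inner x (D.nabla p S.ξ x) (q x) = S.g.inner x (D.nabla q S.ξ x) (p x) := by
    have h := hD.dOne_eta p q x
    rw [hη] at h
    linarith
  have hcyc (p q r : SmoothSec n F E) := (hD.dTwo_fundamental p q r x).symm.trans
    ((congrArg (fun y => 3 * y) (hΩ p q r x)).trans
      ((mul_left_comm _ _ _).trans (congrArg (fun y => 2 * y) (three_mul_wedge p q r x))))
  -- Since `dη = 0`, normality says `N = 0`. Pairing with `φs` turns the `φ ∘ ∇φ` terms of `N` into
  -- terms of `dΩ(s, t, u)`, up to `η`.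
  have hnij : S.g.inner x (L.nijenhuis S.φ t u x) (S.φ x (s x)) = 0 := by
    have h := hN t u x
    rw [hη, mul_zero, zero_smul, add_zero] at h
    rw [h, map_zero, _root_.zero_apply]
  rw [hD.nijenhuis_apply] at hnij
  simp only [map_add, map_sub, _root_.add_apply, _root_.sub_apply,
    S.compat] at hnij
  have hxi (p q : SmoothSec n F E) : (S.η x (D.nablaEnd p S.φ q x) : ℝ)
      = -S.g.inner x (D.nabla p S.ξ x) (S.φ x (q x)) := by
    have h := hD.inner_nablaEnd_skew p q S.ξ x
    rw [S.inner_xi, D.nablaEnd_xi, map_neg, _root_.neg_apply, S.inner_phi] at h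
    linarith
  have hss := hcyc s t u
  have hφφ := hcyc s (S.φ.app t) (S.φ.app u)
  have h1 := hD.inner_nablaEnd_phi_app s u (S.φ.app t) x
  have h2 := hD.inner_nablaEnd_phi_app (S.φ.app u) t s x
  have h3 := hD.inner_nablaEnd_phi_app (S.φ.app t) u s x
  have h4 := hD.inner_nablaEnd_skew (S.φ.app t) s (S.φ.app u) x
  have hy1 := hsymm (S.φ.app t) u
  have hy2 := hsymm (S.φ.app u) t
  have hy3 := hsymm (S.φ.app t) s
  have hy4 := hsymm (S.φ.app u) s
  simp only [EndSec.app_apply, S.eta_phi, S.compat, mul_zero, zero_mul, sub_zero, add_zero]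
    at hφφ h1 h2 h3 h4 hy1 hy2 hy3 hy4
  rw [S.φ_sq, map_add, map_neg, map_smul, S.inner_xi, hxi, smul_eq_mul] at h1
  rw [hxi, hxi] at hnij
  rw [S.inner_phi x (s x)]
  -- Half the Koszul-type combination: `h1`–`h4` move `φ` between slots, and `hy1`–`hy4` cancel the
  -- remaining `∇ξ` terms.
  linear_combination (1 / 2 : ℝ) * hφφ - (1 / 2 : ℝ) * hss - (1 / 2 : ℝ) * h1
    - (1 / 2 : ℝ) * h2 + (1 / 2 : ℝ) * h3 - (1 / 2 : ℝ) * h4 + (1 / 2 : ℝ) * hnij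
    + hD.inner_nablaEnd_skew s t u x
    + (1 / 2 : ℝ) * hD.inner_nablaEnd_skew t s u x
    + (1 / 2 : ℝ) * (S.η x (s x) : ℝ) * (hy1 - hy2)
    + (1 / 2 : ℝ) * (S.η x (u x) : ℝ) * hy3 - (1 / 2 : ℝ) * (S.η x (t x) : ℝ) * hy4

/-- The covariant derivative of `φ` on a Kenmotsu Lie algebroid. -/
lemma IsKenmotsu.nablaEnd_eq (hK : L.IsKenmotsu S) (hD : D.IsLeviCivita S.g)
    (s t : SmoothSec n F E) (x : M) :
    D.nablaEnd s S.φ t x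
      = -((S.η.app t x) • S.φ.app s x) - (metricApp S.g s (S.φ.app t) x) • S.ξ x := by
  -- The difference of the two sides at `x` must be the value of a global section; the coefficient
  -- of `ξ` can be frozen at `x`.
  have hsm : ∃ u : SmoothSec n F E, u x = D.nablaEnd s S.φ t x
      + (S.η.app t x) • S.φ.app s x + (metricApp S.g s (S.φ.app t) x) • S.ξ x :=
    ⟨D.nablaEnd s S.φ t + (S.φ.app s).fsmul (S.η.appSmooth t)
      + (metricApp S.g s (S.φ.app t) x) • S.ξ, rfl⟩
  obtain ⟨u, hu⟩ := hsm
  have h : S.g.inner x (u x) (u x) = 0 := by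
    -- Only the first slot is expanded: the second must remain the value of a section for
    -- `inner_nablaEnd` to apply.
    conv_lhs => enter [1]; rw [hu]
    simp only [map_add, map_smul, _root_.add_apply, _root_.smul_apply, smul_eq_mul,
      hK.inner_nablaEnd hD, EndSec.app_apply, metricApp_apply, OneFormSec.app,
      S.g.symm x (S.ξ x), S.inner_xi]
    ring
  have hu0 : u x = 0 := by
    by_contra hne
    exact (S.g.pos x (u x) hne).ne' h
  rw [hu] at hu0
  rw [← sub_eq_zero, ← hu0]
  abel

/-- A structure with `(∇_s φ) t = -η(t) φ s - g(s, φ t) ξ` satisfies `∇_s ξ = s - η(s) ξ`. -/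
lemma nabla_xi_of_nablaEnd_eq (hD : D.IsLeviCivita S.g)
    (hφ : ∀ (s t : SmoothSec n F E) (x : M), D.nablaEnd s S.φ t x
      = -((S.η.app t x) • S.φ.app s x) - (metricApp S.g s (S.φ.app t) x) • S.ξ x)
    (s : SmoothSec n F E) (x : M) :
    D.nabla s S.ξ x = s x - (S.η x (s x) : ℝ) • S.ξ x := by
  have h := hφ s S.ξ x
  have hξ : S.η.app S.ξ x = 1 := S.η_ξ x
  rw [D.nablaEnd_xi, hξ, one_smul, metricApp_apply, EndSec.app_apply, EndSec.app_apply, S.phi_xi,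
    map_zero, zero_smul, sub_zero, neg_inj] at h
  -- From `φ(∇_s ξ) = φs`, a second `φ` recovers `∇_s ξ`, because `η(∇_s ξ) = 0`.
  have h2 := congrArg (S.φ x) h
  rw [S.φ_sq, S.φ_sq, hD.eta_nabla_xi, zero_smul, add_zero] at h2
  rw [← neg_inj, h2]
  abel

lemma isKenmotsu_of_nablaEnd_eq (hD : D.IsLeviCivita S.g)
    (hφ : ∀ (s t : SmoothSec n F E) (x : M), D.nablaEnd s S.φ t x
      = -((S.η.app t x) • S.φ.app s x) - (metricApp S.g s (S.φ.app t) x) • S.ξ x) :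
    L.IsKenmotsu S := by
  have hη (s t : SmoothSec n F E) (x : M) : L.dOne S.η s t x = 0 := by
    have h := hD.dOne_eta s t x
    rw [nabla_xi_of_nablaEnd_eq hD hφ, nabla_xi_of_nablaEnd_eq hD hφ] at h
    simp only [map_sub, map_smul, _root_.sub_apply, _root_.smul_apply, smul_eq_mul,
      S.g.symm x (S.ξ x), S.inner_xi, S.g.symm x (t x) (s x)] at h
    linarith
  refine ⟨fun s t x => ?_, hη, fun s t u x => ?_⟩
  · rw [hη, mul_zero, zero_smul, add_zero, hD.nijenhuis_apply]
    simp only [hφ, metricApp_apply, EndSec.app_apply, OneFormSec.app, map_sub, map_neg, map_smul,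
      S.phi_xi, S.g.symm x (S.φ x (t x)) (S.φ x (s x))]
    module
  · have h1 := hD.dTwo_fundamental s t u x
    have h2 := three_mul_wedge (S := S) s t u x
    simp only [hφ, metricApp_apply, EndSec.app_apply, OneFormSec.app, map_sub, map_neg, map_smul,
      _root_.sub_apply, _root_.neg_apply, _root_.smul_apply, smul_eq_mul, S.g.symm x (S.ξ x),
      S.inner_xi, S.inner_phi] at h1
    -- Skew-symmetry of `Ω` on the three pairs matches the cyclic sum with the wedge product.
    have hts := S.inner_phi x (t x) (s x)
    have hus := S.inner_phi x (u x) (s x)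
    have hut := S.inner_phi x (u x) (t x)
    rw [S.g.symm x (S.φ x (t x))] at hts
    rw [S.g.symm x (S.φ x (u x))] at hus hut
    linear_combination (1 / 3 : ℝ) * h1 - (2 / 3 : ℝ) * h2
      - (1 / 3 : ℝ) * (S.η x (u x) : ℝ) * hts + (1 / 3 : ℝ) * (S.η x (t x) : ℝ) * hus
      - (1 / 3 : ℝ) * (S.η x (s x) : ℝ) * hut

end LieAlgebroid

end KenmotsuAlgebroid

theorem theorem4p4 {n m : ℕ}
    {M : Type*} [TopologicalSpace M] [T2Space M] [ParacompactSpace M]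
    [ChartedSpace (EuclideanSpace ℝ (Fin n)) M] [IsManifold (𝓡 n) ∞ M]
    {F : Type*} [NormedAddCommGroup F] [NormedSpace ℝ F]
    {E : M → Type*} [TopologicalSpace (Bundle.TotalSpace F E)]
    [∀ x, TopologicalSpace (E x)] [∀ x, AddCommGroup (E x)] [∀ x, Module ℝ (E x)]
    [∀ x, IsTopologicalAddGroup (E x)] [∀ x, ContinuousSMul ℝ (E x)]
    [FiberBundle F E] [VectorBundle ℝ F E] [ContMDiffVectorBundle ∞ F E (𝓡 n)]
    (hrank : Module.finrank ℝ F = 2 * m + 1)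
    (L : LieAlgebroid n F E) (S : AlmostContactRiemannianStr n F E)
    (D : L.Connection) (hD : D.IsLeviCivita S.g) :
    L.IsKenmotsu S ↔
      ∀ (s₁ s₂ : SmoothSec n F E) (x : M),
        D.nablaEnd s₁ S.φ s₂ x
          = -((S.η.app s₂ x) • S.φ.app s₁ x) - (metricApp S.g s₁ (S.φ.app s₂) x) • S.ξ x := by
  exact ⟨fun hK => hK.nablaEnd_eq hD, LieAlgebroid.isKenmotsu_of_nablaEnd_eq hD⟩
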